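/- Let $N=\{1,\dots,n\}$ ($n\ge 1$) be a set of agents, $L=\{1,\dots,l\}$ a set of commodities, $\Omega\in\mathbb{R}^l_+$ a fixed social endowment and $X=\prod_{\ell\in L}[0,\Omega^\ell]$. Say that $\overline{x}\in X$ is between $\widehat{x}$ and $\widetilde{x}$ if for each $\ell$, $\widehat{x}^\ell\le\overline{x}^\ell\le\widetilde{x}^\ell$ or $\widehat{x}^\ell\ge\overline{x}^\ell\ge\widetilde{x}^\ell$. Let $\mathcal{R}$ be the set of all complete, transitive, continuous and strictly convex relations $R_i$ on $X$ (with strict part $P_i$ and indifference $I_i$) that are multidimensional single-peaked: there is a peak $p(R_i)\in X$ such that $x\,P_i\,\widetilde{x}$ whenever $x\ne\widetilde{x}$ and $x$ is between $p(R_i)$ and $\widetilde{x}$. A rule is a function $\varphi$ from $\mathcal{R}^n$ to $\{x\in X^n : \sum_{i\in N} x_i=\Omega\}$. A rule $\varphi$ is strategy-proof if $\varphi_i(R)\,R_i\,\varphi_i(R_i',R_{-i})$ for all $R\in\mathcal{R}^n$, $i\in N$, $R_i'\in\mathcal{R}$; own-peak-only if $p(R_i')=p(R_i)$ implies $\varphi_i(R)=\varphi_i(R_i',R_{-i})$.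 Let $\Phi^\star$ be the set of strategy-proof, own-peak-only rules, and write $\varphi\succcurlyeq\psi$ if $\varphi_i(R)\,R_i\,\psi_i(R)$ for all $R\in\mathcal{R}^n$ and $i\in N$. A rule $\varphi$ is Pareto-undominated strategy-proof if $\varphi\in\Phi^\star$ and, for each $\psi\in\Phi^\star$, $\psi\succcurlyeq\varphi$ implies $\varphi\succcurlyeq\psi$. It satisfies equal treatment if $R_i=R_j$ implies $\varphi_i(R)\,I_i\,\varphi_j(R)$. It satisfies multidimensional replacement monotonicity if for all $R\in\mathcal{R}^n$, $i\in N$, $R_i'\in\mathcal{R}$, $\ell\in L$ and $j\in N\setminus\{i\}$: $\varphi_i^\ell(R)\le\varphi_i^\ell(R_i',R_{-i})$ implies $\varphi_j^\ell(R)\ge\varphi_j^\ell(R_i',R_{-i})$, and $\varphi_i^\ell(R)\ge\varphi_i^\ell(R_i',R_{-i})$ implies $\varphi_j^\ell(R)\le\varphi_j^\ell(R_i',R_{-i})$. The multidimensional uniform rule $u$ is given by $u_i^\ell(R)=\min\{p^\ell(R_i),\lambda^\ell(R)\}$ if $\sum_{j\in N}p^\ell(R_j)\ge\Omega^\ell$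 and $u_i^\ell(R)=\max\{p^\ell(R_i),\lambda^\ell(R)\}$ otherwise, where $\lambda^\ell(R)\ge 0$ solves $\sum_{j\in N}u_j^\ell(R)=\Omega^\ell$. Theorem. For all $n\ge 1$, $l$ and $\Omega\in\mathbb{R}^l_+$, a rule is Pareto-undominated strategy-proof and satisfies equal treatment and multidimensional replacement monotonicity if and only if it is the multidimensional uniform rule $u$. -/

import Mathlib

open scoped BigOperators

noncomputable section

namespace UniformRule

/-- The consumption set `X = ∏ ℓ, [0, Ω ℓ]`, as a set in `ℝ^l`. -/
abbrev X {l : ℕ} (Ω : Fin l → ℝ) : Set (Fin l → ℝ) := Set.Icc 0 Ω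

/-- A preference on `X`: a complete, transitive, continuous and strictly convex relation;
`rel x y` reads "`x` is at least as good as `y`". -/
@[ext]
structure Preference {l : ℕ} (Ω : Fin l → ℝ) where
  rel : X Ω → X Ω → Prop
  complete : ∀ x y, rel x y ∨ rel y x
  transitive : ∀ x y z, rel x y → rel y z → rel x z
  upper_closed : ∀ y, IsClosed {x | rel x y}
  lower_closed : ∀ y, IsClosed {x | rel y x}
  strictly_convex : ∀ x y z w : X Ω, x ≠ y → rel x z → rel y z →
    (w : Fin l → ℝ) ∈ openSegment ℝ (x : Fin l → ℝ) (y : Fin l → ℝ) →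
      rel w z ∧ ¬ rel z w

/-- Strict preference. -/
def Preference.Strict {l : ℕ} {Ω : Fin l → ℝ} (R : Preference Ω) (x y : X Ω) : Prop :=
  R.rel x y ∧ ¬ R.rel y x

/-- Indifference. -/
def Preference.Indiff {l : ℕ} {Ω : Fin l → ℝ} (R : Preference Ω) (x y : X Ω) : Prop :=
  R.rel x y ∧ R.rel y x

/-- `y` is between `x` and `z`, commodity by commodity. -/
def Between {l : ℕ} (x y z : Fin l → ℝ) : Prop :=
  ∀ ℓ, (x ℓ ≤ y ℓ ∧ y ℓ ≤ z ℓ) ∨ (z ℓ ≤ y ℓ ∧ y ℓ ≤ x ℓ)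

/-- `p` is a peak vector of `R`: a bundle between `p` and a different bundle `y` is strictly
better than `y`. -/
def Preference.IsPeakVector {l : ℕ} {Ω : Fin l → ℝ} (R : Preference Ω) (p : X Ω) : Prop :=
  ∀ x y : X Ω, x ≠ y → Between (p : Fin l → ℝ) x y → R.Strict x y

/-- The domain of all multidimensional single-peaked preferences. -/
def Domain {l : ℕ} (Ω : Fin l → ℝ) : Type :=
  {R : Preference Ω // ∃ p, R.IsPeakVector p}

/-- The peak of a multidimensional single-peaked preference. -/
def peak {l : ℕ} {Ω : Fin l → ℝ} (R : Domain Ω) : X Ω := R.2.choose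

theorem isPeakVector_peak {l : ℕ} {Ω : Fin l → ℝ} (R : Domain Ω) :
    R.1.IsPeakVector (peak R) := R.2.choose_spec

/-- The peak is strictly better than every other bundle (so there is only one peak vector, and
it is the most preferred bundle). -/
theorem peak_strict {l : ℕ} {Ω : Fin l → ℝ} (R : Domain Ω) (x : X Ω) (hx : peak R ≠ x) :
    R.1.Strict (peak R) x :=
  isPeakVector_peak R _ _ hx fun ℓ =>
    (le_total ((peak R : Fin l → ℝ) ℓ) ((x : Fin l → ℝ) ℓ)).imp
      (fun h => ⟨le_rfl, h⟩) (fun h => ⟨h, le_rfl⟩)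

/-- Feasible allocations for `n` agents: the whole endowment is distributed. -/
def Allocation (n : ℕ) {l : ℕ} (Ω : Fin l → ℝ) : Type :=
  {x : Fin n → X Ω // ∀ ℓ, ∑ i, (x i : Fin l → ℝ) ℓ = Ω ℓ}

/-- Preference profiles. -/
abbrev Profile (n : ℕ) {l : ℕ} (Ω : Fin l → ℝ) : Type := Fin n → Domain Ω

/-- Allocation rules. -/
def Rule (n : ℕ) {l : ℕ} (Ω : Fin l → ℝ) : Type := Profile n Ω → Allocation n Ω

/-- The bundle that the rule `φ` assigns to agent `i` at the profile `R`. -/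
def Rule.bundle {n l : ℕ} {Ω : Fin l → ℝ} (φ : Rule n Ω) (R : Profile n Ω) (i : Fin n) : X Ω :=
  (φ R).1 i

/-- The amount of commodity `ℓ` that the rule `φ` assigns to agent `i` at the profile `R`. -/
def Rule.amount {n l : ℕ} {Ω : Fin l → ℝ} (φ : Rule n Ω) (R : Profile n Ω) (i : Fin n)
    (ℓ : Fin l) : ℝ :=
  (φ.bundle R i : Fin l → ℝ) ℓ

def StrategyProof {n l : ℕ} {Ω : Fin l → ℝ} (φ : Rule n Ω) : Prop :=
  ∀ (R : Profile n Ω) (i : Fin n) (R' : Domain Ω),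
    (R i).1.rel (φ.bundle R i) (φ.bundle (Function.update R i R') i)

def EqualTreatment {n l : ℕ} {Ω : Fin l → ℝ} (φ : Rule n Ω) : Prop :=
  ∀ (R : Profile n Ω) (i j : Fin n), R i = R j →
    (R i).1.Indiff (φ.bundle R i) (φ.bundle R j)

def ReplacementMonotonic {n l : ℕ} {Ω : Fin l → ℝ} (φ : Rule n Ω) : Prop :=
  ∀ (R : Profile n Ω) (i : Fin n) (R' : Domain Ω) (ℓ : Fin l),
    (φ.amount R i ℓ ≤ φ.amount (Function.update R i R') i ℓ →
      ∀ j, j ≠ i → φ.amount (Function.update R i R') j ℓ ≤ φ.amount R j ℓ) ∧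
    (φ.amount (Function.update R i R') i ℓ ≤ φ.amount R i ℓ →
      ∀ j, j ≠ i → φ.amount R j ℓ ≤ φ.amount (Function.update R i R') j ℓ)

def OwnPeakOnly {n l : ℕ} {Ω : Fin l → ℝ} (φ : Rule n Ω) : Prop :=
  ∀ (R : Profile n Ω) (i : Fin n) (R' : Domain Ω), peak R' = peak (R i) →
    φ.bundle R i = φ.bundle (Function.update R i R') i

/-- `φ` dominates `ψ`: everybody always finds `φ` at least as good as `ψ`. -/
def Dominates {n l : ℕ} {Ω : Fin l → ℝ} (φ ψ : Rule n Ω) : Prop :=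
  ∀ (R : Profile n Ω) (i : Fin n), (R i).1.rel (φ.bundle R i) (ψ.bundle R i)

/-- The class of strategy-proof and own-peak-only rules. -/
def PhiStar (n : ℕ) {l : ℕ} (Ω : Fin l → ℝ) : Set (Rule n Ω) :=
  {φ | StrategyProof φ ∧ OwnPeakOnly φ}

def ParetoUndominatedStrategyProof {n l : ℕ} {Ω : Fin l → ℝ} (φ : Rule n Ω) : Prop :=
  φ ∈ PhiStar n Ω ∧ ∀ ψ ∈ PhiStar n Ω, Dominates ψ φ → Dominates φ ψ

/-- The one-commodity uniform assignment with bound `c`, for an amount `ω` to be divided and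
peaks `q`. (If the peaks add up to `ω`, a total assignment of `ω` in the first case means that
everybody receives her peak, as it also does with the maximum in place of the minimum.) -/
def uniformAmount {n : ℕ} (ω : ℝ) (q : Fin n → ℝ) (c : ℝ) (i : Fin n) : ℝ :=
  if ω ≤ ∑ j, q j then min (q i) c else max (q i) c

theorem exists_bound {n : ℕ} [NeZero n] (ω : ℝ) (q : Fin n → ℝ)
    (hq : ∀ i, q i ∈ Set.Icc 0 ω) : ∃ c, 0 ≤ c ∧ ∑ i, uniformAmount ω q c i = ω := by
  have hω : 0 ≤ ω := (hq 0).1.trans (hq 0).2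
  by_cases h : ω ≤ ∑ j, q j
  · simp only [uniformAmount, if_pos h]
    have hc : ContinuousOn (fun c : ℝ => ∑ i, min (q i) c) (Set.Icc 0 ω) := by fun_prop
    have h0 : ∑ i, min (q i) 0 = 0 := Finset.sum_eq_zero fun i _ => min_eq_right (hq i).1
    have h1 : ∑ i, min (q i) ω = ∑ i, q i := Finset.sum_congr rfl fun i _ => min_eq_left (hq i).2
    obtain ⟨c, hc, e⟩ := intermediate_value_Icc hω hc ⟨h0.le.trans hω, h.trans h1.ge⟩
    exact ⟨c, hc.1, e⟩
  · simp only [uniformAmount, if_neg h]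
    have hc : ContinuousOn (fun c : ℝ => ∑ i, max (q i) c) (Set.Icc 0 ω) := by fun_prop
    have h0 : ∑ i, max (q i) 0 = ∑ i, q i := Finset.sum_congr rfl fun i _ => max_eq_left (hq i).1
    have h1 : ω ≤ ∑ i, max (q i) ω :=
      (le_max_right (q 0) ω).trans <| Finset.single_le_sum (f := fun i => max (q i) ω)
        (fun i _ => hω.trans (le_max_right _ _)) (Finset.mem_univ 0)
    obtain ⟨c, hc, e⟩ := intermediate_value_Icc hω hc ⟨h0.le.trans (not_le.1 h).le, h1⟩
    exact ⟨c, hc.1, e⟩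

theorem uniformAmount_mem {n : ℕ} (ω : ℝ) (q : Fin n → ℝ) (hq : ∀ i, q i ∈ Set.Icc 0 ω)
    (c : ℝ) (hc : 0 ≤ c) (hsum : ∑ i, uniformAmount ω q c i = ω) (i : Fin n) :
    uniformAmount ω q c i ∈ Set.Icc 0 ω := by
  have h0 : ∀ j, 0 ≤ uniformAmount ω q c j := by
    intro j
    unfold uniformAmount
    split_ifs
    · exact le_min (hq j).1 hc
    · exact (hq j).1.trans (le_max_left _ _)
  refine ⟨h0 i, ?_⟩
  calc uniformAmount ω q c i ≤ ∑ j, uniformAmount ω q c j :=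
        Finset.single_le_sum (fun j _ => h0 j) (Finset.mem_univ i)
    _ = ω := hsum

/-- The peak amounts of the agents in commodity `ℓ`. -/
def peakAmounts {n l : ℕ} {Ω : Fin l → ℝ} (R : Profile n Ω) (ℓ : Fin l) : Fin n → ℝ :=
  fun i => (peak (R i) : Fin l → ℝ) ℓ

theorem peakAmounts_mem {n l : ℕ} {Ω : Fin l → ℝ} (R : Profile n Ω) (ℓ : Fin l) (i : Fin n) :
    peakAmounts R ℓ i ∈ Set.Icc 0 (Ω ℓ) :=
  ⟨(peak (R i)).2.1 ℓ, (peak (R i)).2.2 ℓ⟩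

/-- A nonnegative bound for which the uniform assignment of commodity `ℓ` is feasible. -/
def bound {n l : ℕ} [NeZero n] {Ω : Fin l → ℝ} (R : Profile n Ω) (ℓ : Fin l) : ℝ :=
  (exists_bound (Ω ℓ) (peakAmounts R ℓ) (peakAmounts_mem R ℓ)).choose

theorem bound_spec {n l : ℕ} [NeZero n] {Ω : Fin l → ℝ} (R : Profile n Ω) (ℓ : Fin l) :
    0 ≤ bound R ℓ ∧ ∑ i, uniformAmount (Ω ℓ) (peakAmounts R ℓ) (bound R ℓ) i = Ω ℓ :=
  (exists_bound (Ω ℓ) (peakAmounts R ℓ) (peakAmounts_mem R ℓ)).choose_spec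

theorem uniformAmount_bound_mem {n l : ℕ} [NeZero n] {Ω : Fin l → ℝ} (R : Profile n Ω)
    (ℓ : Fin l) (i : Fin n) :
    uniformAmount (Ω ℓ) (peakAmounts R ℓ) (bound R ℓ) i ∈ Set.Icc 0 (Ω ℓ) :=
  uniformAmount_mem _ _ (peakAmounts_mem R ℓ) _ (bound_spec R ℓ).1 (bound_spec R ℓ).2 i

/-- The multidimensional uniform rule. -/
def multidimUniform (n : ℕ) [NeZero n] {l : ℕ} (Ω : Fin l → ℝ) : Rule n Ω := fun R =>
  ⟨fun i => ⟨fun ℓ => uniformAmount (Ω ℓ) (peakAmounts R ℓ) (bound R ℓ) i,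
      fun ℓ => (uniformAmount_bound_mem R ℓ i).1, fun ℓ => (uniformAmount_bound_mem R ℓ i).2⟩,
    fun ℓ => (bound_spec R ℓ).2⟩

end UniformRule

end

namespace UniformRule

/-! Own-peak-only rules cannot tell apart preferences with the same peak, so a welfare comparison
between bundles must hold for every such preference at once. By `between_of_forall_rel` this forces
betweenness in each commodity. Strategy-proofness and domination thus become statements about one
commodity at a time.

For a rule that also satisfies equal treatment and replacement monotonicity, let one agent adopt
another's preference. The amounts of a commodity then turn out to be ordered like the peaks, and
rationed agents are equalized as in the uniform rule. Feasibility then places each uniform amount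
between the peak and the rule's amount, so the uniform rule dominates every such rule
(`multidimUniform_dominates`).

Conversely, the uniform rule puts all agents on the same side of their peaks in each commodity. A
dominating rule would move all amounts in one direction, which the fixed total forbids
(`eq_multidimUniform_of_dominates`). Both implications follow. -/

theorem peak_eq_of_isPeakVector {l : ℕ} {Ω : Fin l → ℝ} (R : Domain Ω) {p : X Ω}
    (hp : R.1.IsPeakVector p) : peak R = p := by
  by_contra h
  have h1 := peak_strict R p h
  have h2 := hp p (peak R) (Ne.symm h) fun ℓ =>
    (le_total ((p : Fin l → ℝ) ℓ) ((peak R : Fin l → ℝ) ℓ)).imp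
      (fun h => ⟨le_rfl, h⟩) (fun h => ⟨h, le_rfl⟩)
  exact h1.2 h2.1

theorem rel_of_between {l : ℕ} {Ω : Fin l → ℝ} (R : Domain Ω) {x y : X Ω}
    (h : Between (peak R : Fin l → ℝ) x y) : R.1.rel x y := by
  by_cases hxy : x = y
  · subst hxy
    exact (R.1.complete x x).elim id id
  · exact (isPeakVector_peak R x y hxy h).1

theorem Between.antisymm {l : ℕ} {p x y : Fin l → ℝ} (h : Between p x y) (h' : Between p y x) :
    x = y := by
  funext ℓ
  rcases h ℓ with h | h <;> rcases h' ℓ with h' | h' <;> linarith [h.1, h.2, h'.1, h'.2]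

/-! ### Separable quadratic preferences -/

/-- A quadratic loss, with the extra coefficient `g` on the side of `0` pointed to by `s`. -/
def loss (ε s g t : ℝ) : ℝ := ε * t ^ 2 + g * max (s * t) 0 ^ 2

theorem continuous_loss (ε s g : ℝ) : Continuous (loss ε s g) := by
  unfold loss
  fun_prop

/-- The one-sided term is convex, and the term `ε * t ^ 2` supplies the explicit gap that later
yields strict convexity. -/
theorem loss_convex {ε s g : ℝ} (hg : 0 ≤ g) {a b : ℝ} (ha : 0 ≤ a) (hb : 0 ≤ b)
    (hab : a + b = 1) (t r : ℝ) :
    loss ε s g (a * t + b * r) + ε * (a * b * (t - r) ^ 2) ≤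
      a * loss ε s g t + b * loss ε s g r := by
  obtain rfl : b = 1 - a := by linarith
  have hm : max (s * (a * t + (1 - a) * r)) 0 ≤
      a * max (s * t) 0 + (1 - a) * max (s * r) 0 := by
    refine max_le ?_ (by positivity)
    nlinarith [mul_le_mul_of_nonneg_left (le_max_left (s * t) 0) ha,
      mul_le_mul_of_nonneg_left (le_max_left (s * r) 0) hb]
  have hsq := pow_le_pow_left₀ (le_max_right _ _) hm 2
  have h2 : (a * max (s * t) 0 + (1 - a) * max (s * r) 0) ^ 2 ≤
      a * max (s * t) 0 ^ 2 + (1 - a) * max (s * r) 0 ^ 2 := by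
    nlinarith [mul_nonneg (mul_nonneg ha hb) (sq_nonneg (max (s * t) 0 - max (s * r) 0))]
  have h3 := mul_le_mul_of_nonneg_left (hsq.trans h2) hg
  unfold loss
  nlinarith [h3]

theorem loss_mono {ε s g : ℝ} (hg : 0 ≤ g) {t r : ℝ}
    (h : (0 ≤ t ∧ t ≤ r) ∨ (r ≤ t ∧ t ≤ 0)) :
    loss ε s g t + ε * (r ^ 2 - t ^ 2) ≤ loss ε s g r := by
  have hm : max (s * t) 0 ≤ max (s * r) 0 := by
    refine max_le ?_ (le_max_right _ _)
    rcases h with ⟨h1, h2⟩ | ⟨h1, h2⟩ <;> rcases le_total 0 s with hs | hs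
    · exact (mul_le_mul_of_nonneg_left h2 hs).trans (le_max_left _ _)
    · exact (mul_nonpos_of_nonpos_of_nonneg hs h1).trans (le_max_right _ _)
    · exact (mul_nonpos_of_nonneg_of_nonpos hs h2).trans (le_max_right _ _)
    · exact (mul_le_mul_of_nonpos_left h1 hs).trans (le_max_left _ _)
  have := mul_le_mul_of_nonneg_left (pow_le_pow_left₀ (le_max_right _ _) hm 2) hg
  unfold loss
  linarith

/-- The total loss of the bundle `z` relative to the bliss point `p`. -/
def totalLoss {l : ℕ} (p : Fin l → ℝ) (ε s : ℝ) (g : Fin l → ℝ) (z : Fin l → ℝ) : ℝ :=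
  ∑ k, loss ε s (g k) (z k - p k)

theorem continuous_totalLoss {l : ℕ} (p : Fin l → ℝ) (ε s : ℝ) (g : Fin l → ℝ) :
    Continuous (totalLoss p ε s g) :=
  continuous_finsetSum _ fun k _ =>
    (continuous_loss ε s (g k)).comp ((continuous_apply k).sub continuous_const)

theorem totalLoss_lt_of_mem_openSegment {l : ℕ} {p : Fin l → ℝ} {ε s : ℝ} {g : Fin l → ℝ}
    (hε : 0 < ε) (hg : ∀ k, 0 ≤ g k) {x y w : Fin l → ℝ} {c : ℝ} (hxy : x ≠ y)
    (hx : totalLoss p ε s g x ≤ c) (hy : totalLoss p ε s g y ≤ c)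
    (hw : w ∈ openSegment ℝ x y) : totalLoss p ε s g w < c := by
  obtain ⟨a, b, ha, hb, hab, rfl⟩ := hw
  obtain ⟨k, hk⟩ := Function.ne_iff.1 hxy
  have hgap : ∀ m, loss ε s (g m) ((a • x + b • y) m - p m) + ε * (a * b * (x m - y m) ^ 2) ≤
      a * loss ε s (g m) (x m - p m) + b * loss ε s (g m) (y m - p m) := by
    intro m
    have h := loss_convex (ε := ε) (s := s) (hg m) ha.le hb.le hab (x m - p m) (y m - p m)
    have e1 : (a • x + b • y) m - p m = a * (x m - p m) + b * (y m - p m) := by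
      simp only [Pi.add_apply, Pi.smul_apply, smul_eq_mul]
      linear_combination p m * hab
    rw [e1]
    have e2 : x m - p m - (y m - p m) = x m - y m := by ring
    rwa [e2] at h
  have hlt : totalLoss p ε s g (a • x + b • y) <
      ∑ m, (a * loss ε s (g m) (x m - p m) + b * loss ε s (g m) (y m - p m)) := by
    refine Finset.sum_lt_sum (fun m _ => ?_) ⟨k, Finset.mem_univ k, ?_⟩
    · have : 0 ≤ ε * (a * b * (x m - y m) ^ 2) := by positivity
      linarith [hgap m]
    · have : 0 < (x k - y k) ^ 2 := by
        have := sub_ne_zero.2 hk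
        positivity
      have : 0 < ε * (a * b * (x k - y k) ^ 2) := by positivity
      linarith [hgap k]
  rw [Finset.sum_add_distrib, ← Finset.mul_sum, ← Finset.mul_sum] at hlt
  calc totalLoss p ε s g (a • x + b • y)
      < a * totalLoss p ε s g x + b * totalLoss p ε s g y := hlt
    _ ≤ a * c + b * c := by gcongr
    _ = c := by rw [← add_mul, hab, one_mul]

theorem totalLoss_lt_of_between {l : ℕ} {p : Fin l → ℝ} {ε s : ℝ} {g : Fin l → ℝ}
    (hε : 0 < ε) (hg : ∀ k, 0 ≤ g k) {x y : Fin l → ℝ} (hxy : x ≠ y) (h : Between p x y) :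
    totalLoss p ε s g x < totalLoss p ε s g y := by
  obtain ⟨k, hk⟩ := Function.ne_iff.1 hxy
  have hside : ∀ m, (0 ≤ x m - p m ∧ x m - p m ≤ y m - p m) ∨
      (y m - p m ≤ x m - p m ∧ x m - p m ≤ 0) := fun m =>
    (h m).imp (fun h => ⟨by linarith [h.1], by linarith [h.2]⟩)
      (fun h => ⟨by linarith [h.1], by linarith [h.2]⟩)
  have hsq : ∀ m, 0 ≤ (y m - p m) ^ 2 - (x m - p m) ^ 2 := by
    intro m
    rcases hside m with ⟨h1, h2⟩ | ⟨h1, h2⟩ <;> nlinarith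
  have hsq' : 0 < (y k - p k) ^ 2 - (x k - p k) ^ 2 := by
    rcases lt_or_gt_of_ne hk with h0 | h0 <;> rcases hside k with ⟨h1, h2⟩ | ⟨h1, h2⟩ <;> nlinarith
  refine Finset.sum_lt_sum (fun m _ => ?_) ⟨k, Finset.mem_univ k, ?_⟩
  · linarith [loss_mono (ε := ε) (s := s) (hg m) (hside m), mul_nonneg hε.le (hsq m)]
  · linarith [loss_mono (ε := ε) (s := s) (hg k) (hside k), mul_pos hε hsq']

/-- The preference that ranks bundles by a separable quadratic loss. -/
def quadraticPreference {l : ℕ} {Ω : Fin l → ℝ} (p : X Ω) {ε : ℝ} (s : ℝ) {g : Fin l → ℝ}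
    (hε : 0 < ε) (hg : ∀ k, 0 ≤ g k) : Domain Ω :=
  ⟨{ rel := fun x y => totalLoss p ε s g x ≤ totalLoss p ε s g y
     complete := fun _ _ => le_total _ _
     transitive := fun _ _ _ => le_trans
     upper_closed := fun _ => isClosed_le
       ((continuous_totalLoss _ _ _ _).comp continuous_subtype_val) continuous_const
     lower_closed := fun _ => isClosed_le continuous_const
       ((continuous_totalLoss _ _ _ _).comp continuous_subtype_val)
     strictly_convex := fun x y z w hxy hx hy hw => by
       have h := totalLoss_lt_of_mem_openSegment hε hg (Subtype.coe_ne_coe.2 hxy) hx hy hw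
       exact ⟨h.le, not_le.2 h⟩ },
    p, fun x y hxy h => by
      have h := totalLoss_lt_of_between (s := s) hε hg (Subtype.coe_ne_coe.2 hxy) h
      exact ⟨h.le, not_le.2 h⟩⟩

theorem peak_quadraticPreference {l : ℕ} {Ω : Fin l → ℝ} (p : X Ω) {ε : ℝ} (s : ℝ)
    {g : Fin l → ℝ} (hε : 0 < ε) (hg : ∀ k, 0 ≤ g k) :
    peak (quadraticPreference p s hε hg) = p :=
  peak_eq_of_isPeakVector _ fun x y hxy h => by
    have h := totalLoss_lt_of_between (s := s) hε hg (Subtype.coe_ne_coe.2 hxy) h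
    exact ⟨h.le, not_le.2 h⟩

/-- A bundle that every preference with peak `p` ranks weakly above `y` is between `p` and `y`. -/
theorem between_of_forall_rel {l : ℕ} {Ω : Fin l → ℝ} {p x y : X Ω}
    (h : ∀ Q : Domain Ω, peak Q = p → Q.1.rel x y) : Between (p : Fin l → ℝ) x y := by
  intro ℓ
  obtain ⟨x, hx⟩ := x
  obtain ⟨y, hy⟩ := y
  obtain ⟨p, hp⟩ := p
  by_contra hb
  simp only at hb
  -- The sign `s` selects the side of the peak on which `x ℓ` lies; `y` does not go as far on that
  -- side.
  obtain ⟨s, hs⟩ : ∃ s : ℝ, max (s * (y ℓ - p ℓ)) 0 < max (s * (x ℓ - p ℓ)) 0 := by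
    rcases lt_trichotomy (x ℓ) (p ℓ) with h1 | h1 | h1
    · refine ⟨-1, max_lt (lt_max_of_lt_left ?_) (lt_max_of_lt_left (by linarith))⟩
      by_contra h2
      exact hb (Or.inr ⟨by linarith, h1.le⟩)
    · exact absurd ((le_total (p ℓ) (y ℓ)).imp (fun h => ⟨h1.ge, h1.le.trans h⟩)
        fun h => ⟨h.trans h1.ge, h1.le⟩) hb
    · refine ⟨1, max_lt (lt_max_of_lt_left ?_) (lt_max_of_lt_left (by linarith))⟩
      by_contra h2
      exact hb (Or.inl ⟨h1.le, by linarith⟩)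
  set δ := max (s * (x ℓ - p ℓ)) 0 ^ 2 - max (s * (y ℓ - p ℓ)) 0 ^ 2 with hδ
  have hδ0 : 0 < δ := sub_pos.2 (pow_lt_pow_left₀ hs (le_max_right _ _) two_ne_zero)
  set K := ∑ k, (y k - p k) ^ 2 with hK
  have hK0 : 0 ≤ K := Finset.sum_nonneg fun k _ => sq_nonneg _
  -- The symmetric weight is so small that the whole symmetric loss of `y` stays below the one-sided
  -- advantage `δ`, making `y` strictly better; `K + 1` avoids dividing by zero.
  have hε : 0 < δ / (K + 1) := by positivity
  have hg : ∀ k, 0 ≤ (Pi.single ℓ 1 : Fin l → ℝ) k := fun k => by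
    rw [Pi.single_apply]
    split_ifs <;> norm_num
  have key : ∀ z : Fin l → ℝ, totalLoss p (δ / (K + 1)) s (Pi.single ℓ 1) z =
      δ / (K + 1) * ∑ k, (z k - p k) ^ 2 + max (s * (z ℓ - p ℓ)) 0 ^ 2 := by
    intro z
    simp [totalLoss, loss, Finset.sum_add_distrib, Finset.mul_sum, Pi.single_apply]
  have := h (quadraticPreference ⟨p, hp⟩ s hε hg) (peak_quadraticPreference _ _ _ _)
  change totalLoss p (δ / (K + 1)) s (Pi.single ℓ 1) x ≤
    totalLoss p (δ / (K + 1)) s (Pi.single ℓ 1) y at this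
  rw [key, key, ← hK] at this
  have h1 : 0 ≤ δ / (K + 1) * ∑ k, (x k - p k) ^ 2 :=
    mul_nonneg hε.le (Finset.sum_nonneg fun k _ => sq_nonneg _)
  have h2 : δ / (K + 1) * K < δ := by
    rw [div_mul_eq_mul_div, div_lt_iff₀ (by positivity)]
    nlinarith
  linarith

/-! ### The uniform assignment of one commodity -/

theorem exists_lt_of_sum_eq {n : ℕ} {f g : Fin n → ℝ} (h : ∑ k, f k = ∑ k, g k) {i : Fin n}
    (hi : f i < g i) : ∃ k, g k < f k := by
  by_contra! hk
  exact (Finset.sum_lt_sum (fun k _ => hk k) ⟨i, Finset.mem_univ i, hi⟩).ne h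

section uniformAmount

variable {n : ℕ} {ω : ℝ} {q q' : Fin n → ℝ} {c c' : ℝ} {i : Fin n}

/-- Agents with unchanged peaks all move weakly in the same direction, whether the bound or the
regime changes. If `j` gained, balance would require a loser other than `i`. -/
theorem uniformAmount_replacement (hs : ∑ k, uniformAmount ω q c k = ω)
    (hs' : ∑ k, uniformAmount ω q' c' k = ω) (hq : ∀ k, k ≠ i → q' k = q k)
    (h : uniformAmount ω q c i ≤ uniformAmount ω q' c' i) {j : Fin n} (hj : j ≠ i) :
    uniformAmount ω q' c' j ≤ uniformAmount ω q c j := by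
  by_contra! hlt
  obtain ⟨k, hk⟩ := exists_lt_of_sum_eq (hs.trans hs'.symm) hlt
  have hki : k ≠ i := by
    rintro rfl
    exact hk.not_ge h
  have ej := hq j hj
  have ek := hq k hki
  unfold uniformAmount at hlt hk
  rw [ej] at hlt
  rw [ek] at hk
  split_ifs at hlt hk
  · exact absurd (lt_imp_lt_of_le_imp_le (min_le_min_left _) hlt)
      (lt_imp_lt_of_le_imp_le (min_le_min_left _) hk).not_gt
  · exact absurd hk ((min_le_left _ _).trans (le_max_left _ _)).not_gt
  · exact absurd hlt ((min_le_left _ _).trans (le_max_left _ _)).not_gt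
  · exact absurd (lt_imp_lt_of_le_imp_le (max_le_max_left _) hlt)
      (lt_imp_lt_of_le_imp_le (max_le_max_left _) hk).not_gt

/-- An agent below her peak receives the bound `c`. If a misreport gave her more, some other agent
would lose, forcing the `min` regime with `c' < c`, under which she gets less. The case above the
peak is symmetric. -/
theorem uniformAmount_between (hs : ∑ k, uniformAmount ω q c k = ω)
    (hs' : ∑ k, uniformAmount ω q' c' k = ω) (hq : ∀ k, k ≠ i → q' k = q k) :
    (q i ≤ uniformAmount ω q c i ∧ uniformAmount ω q c i ≤ uniformAmount ω q' c' i) ∨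
      (uniformAmount ω q' c' i ≤ uniformAmount ω q c i ∧ uniformAmount ω q c i ≤ q i) := by
  by_contra! hb
  rcases lt_trichotomy (uniformAmount ω q c i) (uniformAmount ω q' c' i) with h | h | h
  · have h1 : uniformAmount ω q c i < q i := by
      by_contra! h1
      exact (hb.1 h1).not_gt h
    obtain ⟨k, hk⟩ := exists_lt_of_sum_eq (hs.trans hs'.symm) h
    have hki : k ≠ i := by
      rintro rfl
      exact hk.not_gt h
    have ek := hq k hki
    unfold uniformAmount at h h1 hk
    rw [ek] at hk
    clear hb hs hs' hq ek hki
    split_ifs at h h1 hk <;> grind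
  · rcases le_total (q i) (uniformAmount ω q c i) with h1 | h1
    · exact (hb.1 h1).ne' h
    · exact (hb.2 h.ge).not_ge h1
  · have h1 : q i < uniformAmount ω q c i := hb.2 h.le
    obtain ⟨k, hk⟩ := exists_lt_of_sum_eq (hs'.trans hs.symm) h
    have hki : k ≠ i := by
      rintro rfl
      exact hk.not_gt h
    have ek := hq k hki
    unfold uniformAmount at h h1 hk
    rw [ek] at hk
    clear hb hs hs' hq ek hki
    split_ifs at h h1 hk <;> grind

end uniformAmount

/-! ### Strategy-proof own-peak-only rules -/

section Rule

variable {n l : ℕ} {Ω : Fin l → ℝ} {φ ψ : Rule n Ω}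

theorem peakAmounts_update_of_ne (R : Profile n Ω) {i k : Fin n} (R' : Domain Ω) (ℓ : Fin l)
    (hk : k ≠ i) : peakAmounts (Function.update R i R') ℓ k = peakAmounts R ℓ k := by
  unfold peakAmounts
  rw [Function.update_of_ne hk]

theorem Rule.ext_amount (h : ∀ R i ℓ, φ.amount R i ℓ = ψ.amount R i ℓ) : φ = ψ :=
  funext fun R => Subtype.ext <| funext fun i => Subtype.ext <| funext fun ℓ => h R i ℓ

theorem Rule.sum_amount (φ : Rule n Ω) (R : Profile n Ω) (ℓ : Fin l) :
    ∑ i, φ.amount R i ℓ = Ω ℓ := (φ R).2 ℓ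

theorem between_of_strategyProof (hsp : StrategyProof φ) (hop : OwnPeakOnly φ) (R : Profile n Ω)
    (i : Fin n) (R' : Domain Ω) :
    Between (peak (R i) : Fin l → ℝ) (φ.bundle R i) (φ.bundle (Function.update R i R') i) := by
  refine between_of_forall_rel fun Q hQ => ?_
  have h := hsp (Function.update R i Q) i R'
  rwa [Function.update_self, Function.update_idem, ← hop R i Q hQ] at h

theorem strategyProof_of_between
    (h : ∀ (R : Profile n Ω) (i : Fin n) (R' : Domain Ω),
      Between (peak (R i) : Fin l → ℝ) (φ.bundle R i) (φ.bundle (Function.update R i R') i)) :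
    StrategyProof φ := fun R i R' => rel_of_between (R i) (h R i R')

theorem ownPeakOnly_of_between
    (h : ∀ (R : Profile n Ω) (i : Fin n) (R' : Domain Ω),
      Between (peak (R i) : Fin l → ℝ) (φ.bundle R i) (φ.bundle (Function.update R i R') i)) :
    OwnPeakOnly φ := by
  intro R i R' hR'
  have h' := h (Function.update R i R') i (R i)
  rw [Function.update_self, Function.update_idem, Function.update_eq_self, hR'] at h'
  exact Subtype.ext ((h R i R').antisymm h')

/-- Domination of one own-peak-only rule over another is a betweenness relation. -/
theorem between_of_dominates (hφ : OwnPeakOnly φ) (hψ : OwnPeakOnly ψ) (h : Dominates ψ φ)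
    (R : Profile n Ω) (i : Fin n) :
    Between (peak (R i) : Fin l → ℝ) (ψ.bundle R i) (φ.bundle R i) := by
  refine between_of_forall_rel fun Q hQ => ?_
  have h := h (Function.update R i Q) i
  rwa [Function.update_self, ← hφ R i Q hQ, ← hψ R i Q hQ] at h

/-- Betweenness in both directions fixes the amount of `i`; replacement monotonicity, applied both
ways to this equality, fixes the others. -/
theorem amount_update_eq_of_peak_eq (hsp : StrategyProof φ) (hop : OwnPeakOnly φ)
    (hrm : ReplacementMonotonic φ) (R : Profile n Ω) (i : Fin n) (R' : Domain Ω) (ℓ : Fin l)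
    (h : (peak R' : Fin l → ℝ) ℓ = (peak (R i) : Fin l → ℝ) ℓ) (j : Fin n) :
    φ.amount (Function.update R i R') j ℓ = φ.amount R j ℓ := by
  have hi : φ.amount (Function.update R i R') i ℓ = φ.amount R i ℓ := by
    have h1 := between_of_strategyProof hsp hop R i R' ℓ
    have h2 := between_of_strategyProof hsp hop (Function.update R i R') i (R i) ℓ
    rw [Function.update_self, Function.update_idem, Function.update_eq_self, h] at h2
    unfold Rule.amount
    rcases h1 with h1 | h1 <;> rcases h2 with h2 | h2 <;> linarith [h1.1, h1.2, h2.1, h2.2]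
  by_cases hj : j = i
  · rw [hj, hi]
  · exact le_antisymm ((hrm R i R' ℓ).1 hi.ge j hj) ((hrm R i R' ℓ).2 hi.le j hj)

/-- Giving both agents any other preference with the same peak changes no bundle, so indifference
holds for all these preferences, which upgrades it to equality. -/
theorem bundle_eq_of_eq (hsp : StrategyProof φ) (hop : OwnPeakOnly φ) (het : EqualTreatment φ)
    (hrm : ReplacementMonotonic φ) {R : Profile n Ω} {i j : Fin n} (h : R i = R j) :
    φ.bundle R i = φ.bundle R j := by
  have key : ∀ Q : Domain Ω, peak Q = peak (R i) →
      Q.1.Indiff (φ.bundle R i) (φ.bundle R j) := by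
    intro Q hQ
    set T := Function.update R i Q with hT
    have e1 : ∀ k, φ.bundle T k = φ.bundle R k := fun k => Subtype.ext <| funext fun ℓ =>
      amount_update_eq_of_peak_eq hsp hop hrm R i Q ℓ (by rw [hQ]) k
    have hTj : peak Q = peak (T j) := by
      by_cases hij : j = i
      · rw [hij, hT, Function.update_self]
      · rw [hT, Function.update_of_ne hij, ← h, hQ]
    have e2 : ∀ k, φ.bundle (Function.update T j Q) k = φ.bundle R k := fun k =>
      (Subtype.ext <| funext fun ℓ =>
        amount_update_eq_of_peak_eq hsp hop hrm T j Q ℓ (by rw [hTj]) k).trans (e1 k)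
    have hi : Function.update T j Q i = Q := by
      by_cases hij : i = j
      · rw [hij, Function.update_self]
      · rw [Function.update_of_ne hij, hT, Function.update_self]
    have h2 := het (Function.update T j Q) i j (by rw [hi, Function.update_self])
    rwa [hi, e2, e2] at h2
  exact Subtype.ext <| Between.antisymm (between_of_forall_rel fun Q hQ => (key Q hQ).1)
    (between_of_forall_rel fun Q hQ => (key Q hQ).2)

/-- If `i` adopts the preference of `j`, both receive the same; what `i` receives moves in a
way constrained by betweenness and what `j` receives moves in the opposite direction. -/
theorem exists_common_amount (hsp : StrategyProof φ) (hop : OwnPeakOnly φ)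
    (het : EqualTreatment φ) (hrm : ReplacementMonotonic φ) (R : Profile n Ω) {i j : Fin n}
    (hij : i ≠ j) (ℓ : Fin l) :
    ∃ a, ((peakAmounts R ℓ i ≤ φ.amount R i ℓ ∧ φ.amount R i ℓ ≤ a) ∨
        (a ≤ φ.amount R i ℓ ∧ φ.amount R i ℓ ≤ peakAmounts R ℓ i)) ∧
      ((peakAmounts R ℓ j ≤ a ∧ a ≤ φ.amount R i ℓ) ∨
        (φ.amount R i ℓ ≤ a ∧ a ≤ peakAmounts R ℓ j)) ∧
      (φ.amount R i ℓ ≤ a → a ≤ φ.amount R j ℓ) ∧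
      (a ≤ φ.amount R i ℓ → φ.amount R j ℓ ≤ a) := by
  have h1 := between_of_strategyProof hsp hop R i (R j) ℓ
  have h2 := between_of_strategyProof hsp hop (Function.update R i (R j)) i (R i) ℓ
  rw [Function.update_self, Function.update_idem, Function.update_eq_self] at h2
  have e : φ.amount (Function.update R i (R j)) i ℓ =
      φ.amount (Function.update R i (R j)) j ℓ := by
    unfold Rule.amount
    rw [bundle_eq_of_eq hsp hop het hrm]
    rw [Function.update_self, Function.update_of_ne hij.symm]
  have h3 := hrm R i (R j) ℓ
  refine ⟨φ.amount (Function.update R i (R j)) i ℓ, h1, h2, fun h => ?_, fun h => ?_⟩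
  · exact e.le.trans (h3.1 h j hij.symm)
  · exact (h3.2 h j hij.symm).trans e.ge

theorem amount_le_amount_of_peak_le (hsp : StrategyProof φ) (hop : OwnPeakOnly φ)
    (het : EqualTreatment φ) (hrm : ReplacementMonotonic φ) (R : Profile n Ω) {i j : Fin n}
    (ℓ : Fin l) (h : peakAmounts R ℓ i ≤ peakAmounts R ℓ j) :
    φ.amount R i ℓ ≤ φ.amount R j ℓ := by
  by_cases hij : i = j
  · rw [hij]
  obtain ⟨a, h1, h2, h3, h4⟩ := exists_common_amount hsp hop het hrm R hij ℓ
  -- If `a` were below the amount of `i`, `h1` would put that amount at or below the peak of `i` and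
  -- `h2` would put `a` at or above the peak of `j`, against `h`. Otherwise `h3` concludes.
  grind

theorem amount_eq_of_amount_lt_peak (hsp : StrategyProof φ) (hop : OwnPeakOnly φ)
    (het : EqualTreatment φ) (hrm : ReplacementMonotonic φ) (R : Profile n Ω) {i j : Fin n}
    (ℓ : Fin l) (h : peakAmounts R ℓ i ≤ peakAmounts R ℓ j)
    (hi : φ.amount R i ℓ < peakAmounts R ℓ i) : φ.amount R j ℓ = φ.amount R i ℓ := by
  by_cases hij : i = j
  · rw [hij]
  obtain ⟨a, h1, h2, h3, h4⟩ := exists_common_amount hsp hop het hrm R hij ℓ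
  grind

theorem amount_eq_of_peak_lt_amount (hsp : StrategyProof φ) (hop : OwnPeakOnly φ)
    (het : EqualTreatment φ) (hrm : ReplacementMonotonic φ) (R : Profile n Ω) {i j : Fin n}
    (ℓ : Fin l) (h : peakAmounts R ℓ i ≤ peakAmounts R ℓ j)
    (hj : peakAmounts R ℓ j < φ.amount R j ℓ) : φ.amount R i ℓ = φ.amount R j ℓ := by
  by_cases hij : j = i
  · rw [hij]
  -- The roles are swapped: here `j` adopts the preference of `i`, and `a` must equal the amount of
  -- `j`.
  obtain ⟨a, h1, h2, h3, h4⟩ := exists_common_amount hsp hop het hrm R hij ℓ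
  grind

/-- Every agent's uniform amount is between her peak and what `φ` gives her. -/
theorem uniformAmount_between_amount (hsp : StrategyProof φ) (hop : OwnPeakOnly φ)
    (het : EqualTreatment φ) (hrm : ReplacementMonotonic φ) (R : Profile n Ω)
    (ℓ : Fin l) {c : ℝ}
    (hc : ∑ k, uniformAmount (Ω ℓ) (peakAmounts R ℓ) c k = Ω ℓ) (k : Fin n) :
    (peakAmounts R ℓ k ≤ uniformAmount (Ω ℓ) (peakAmounts R ℓ) c k ∧
        uniformAmount (Ω ℓ) (peakAmounts R ℓ) c k ≤ φ.amount R k ℓ) ∨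
      (φ.amount R k ℓ ≤ uniformAmount (Ω ℓ) (peakAmounts R ℓ) c k ∧
        uniformAmount (Ω ℓ) (peakAmounts R ℓ) c k ≤ peakAmounts R ℓ k) := by
  have hsum := hc.trans (φ.sum_amount R ℓ).symm
  unfold uniformAmount at hsum ⊢
  split_ifs at hsum ⊢ with hd
  · rcases le_or_gt (peakAmounts R ℓ k) c with hk | hk
    · rw [min_eq_left hk]
      exact (le_total _ _).imp (fun h => ⟨le_rfl, h⟩) fun h => ⟨h, le_rfl⟩
    · rw [min_eq_right hk.le]
      refine Or.inr ⟨?_, hk.le⟩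
      -- If `k` gets more than `c`, some `j` gets less than both its peak and `c`. Equalization (if
      -- the peak of `j` is the lower one) or monotonicity in peaks then gives `k` at most what `j`
      -- has.
      by_contra! hlt
      obtain ⟨j, hj⟩ := exists_lt_of_sum_eq hsum (i := k) (by rwa [min_eq_right hk.le])
      have h1 := hj.trans_le (min_le_left _ _)
      have h2 := hj.trans_le (min_le_right _ _)
      rcases le_total (peakAmounts R ℓ j) (peakAmounts R ℓ k) with h | h
      · linarith [amount_eq_of_amount_lt_peak hsp hop het hrm R ℓ h h1]
      · linarith [amount_le_amount_of_peak_le hsp hop het hrm R ℓ h]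
  · rcases le_or_gt c (peakAmounts R ℓ k) with hk | hk
    · rw [max_eq_left hk]
      exact (le_total _ _).imp (fun h => ⟨le_rfl, h⟩) fun h => ⟨h, le_rfl⟩
    · rw [max_eq_right hk.le]
      refine Or.inl ⟨hk.le, ?_⟩
      by_contra! hlt
      obtain ⟨j, hj⟩ := exists_lt_of_sum_eq hsum.symm (i := k) (by rwa [max_eq_right hk.le])
      have h1 := (le_max_left _ _).trans_lt hj
      have h2 := (le_max_right _ _).trans_lt hj
      rcases le_total (peakAmounts R ℓ j) (peakAmounts R ℓ k) with h | h
      · linarith [amount_le_amount_of_peak_le hsp hop het hrm R ℓ h]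
      · linarith [amount_eq_of_peak_lt_amount hsp hop het hrm R ℓ h h1]

end Rule

/-! ### The multidimensional uniform rule -/

section Uniform

variable {n l : ℕ} [NeZero n] {Ω : Fin l → ℝ}

theorem multidimUniform_between (R : Profile n Ω) (i : Fin n) (R' : Domain Ω) :
    Between (peak (R i) : Fin l → ℝ) ((multidimUniform n Ω).bundle R i)
      ((multidimUniform n Ω).bundle (Function.update R i R') i) := fun ℓ =>
  uniformAmount_between (bound_spec R ℓ).2 (bound_spec (Function.update R i R') ℓ).2
    fun _ hk => peakAmounts_update_of_ne R R' ℓ hk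

theorem multidimUniform_mem_phiStar : multidimUniform n Ω ∈ PhiStar n Ω :=
  ⟨strategyProof_of_between multidimUniform_between,
    ownPeakOnly_of_between multidimUniform_between⟩

theorem equalTreatment_multidimUniform : EqualTreatment (multidimUniform n Ω) := by
  intro R i j h
  have e : (multidimUniform n Ω).bundle R i = (multidimUniform n Ω).bundle R j :=
    Subtype.ext <| funext fun ℓ => by
      change uniformAmount (Ω ℓ) (peakAmounts R ℓ) (bound R ℓ) i =
        uniformAmount (Ω ℓ) (peakAmounts R ℓ) (bound R ℓ) j
      have hq : peakAmounts R ℓ i = peakAmounts R ℓ j := by rw [peakAmounts, peakAmounts, h]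
      rw [uniformAmount, uniformAmount, hq]
  rw [e]
  have h := ((R i).1.complete ((multidimUniform n Ω).bundle R j)
    ((multidimUniform n Ω).bundle R j)).elim id id
  exact ⟨h, h⟩

theorem replacementMonotonic_multidimUniform : ReplacementMonotonic (multidimUniform n Ω) :=
  fun R i R' ℓ =>
    ⟨fun h _ hj => uniformAmount_replacement (bound_spec R ℓ).2
        (bound_spec (Function.update R i R') ℓ).2
        (fun _ hk => peakAmounts_update_of_ne R R' ℓ hk) h hj,
      fun h _ hj => uniformAmount_replacement (bound_spec (Function.update R i R') ℓ).2
        (bound_spec R ℓ).2 (fun _ hk => (peakAmounts_update_of_ne R R' ℓ hk).symm) h hj⟩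

theorem eq_multidimUniform_of_dominates {ψ : Rule n Ω} (hψ : OwnPeakOnly ψ)
    (h : Dominates ψ (multidimUniform n Ω)) : ψ = multidimUniform n Ω := by
  refine Rule.ext_amount fun R i ℓ => ?_
  have hb : ∀ k, _ := fun k =>
    between_of_dominates multidimUniform_mem_phiStar.2 hψ h R k ℓ
  have hsum : ∑ k, ψ.amount R k ℓ = ∑ k, (multidimUniform n Ω).amount R k ℓ :=
    (ψ.sum_amount R ℓ).trans ((multidimUniform n Ω).sum_amount R ℓ).symm
  have hu : ∀ k, (multidimUniform n Ω).amount R k ℓ =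
      uniformAmount (Ω ℓ) (peakAmounts R ℓ) (bound R ℓ) k := fun _ => rfl
  by_cases hd : Ω ℓ ≤ ∑ j, peakAmounts R ℓ j
  · have hle : ∀ k, (multidimUniform n Ω).amount R k ℓ ≤ ψ.amount R k ℓ := by
      intro k
      have h1 : (multidimUniform n Ω).amount R k ℓ ≤ (peak (R k) : Fin l → ℝ) ℓ := by
        rw [hu, uniformAmount, if_pos hd]
        exact min_le_left _ _
      rcases hb k with h2 | h2
      · exact h1.trans h2.1
      · exact h2.1
    exact ((Finset.sum_eq_sum_iff_of_le fun k _ => hle k).1 hsum.symm i (Finset.mem_univ i)).symm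
  · have hle : ∀ k, ψ.amount R k ℓ ≤ (multidimUniform n Ω).amount R k ℓ := by
      intro k
      have h1 : (peak (R k) : Fin l → ℝ) ℓ ≤ (multidimUniform n Ω).amount R k ℓ := by
        rw [hu, uniformAmount, if_neg hd]
        exact le_max_left _ _
      rcases hb k with h2 | h2
      · exact h2.2
      · exact h2.2.trans h1
    exact (Finset.sum_eq_sum_iff_of_le fun k _ => hle k).1 hsum i (Finset.mem_univ i)

theorem multidimUniform_dominates {φ : Rule n Ω} (hφ : φ ∈ PhiStar n Ω)
    (het : EqualTreatment φ) (hrm : ReplacementMonotonic φ) :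
    Dominates (multidimUniform n Ω) φ := fun R i =>
  rel_of_between (R i) fun ℓ =>
    uniformAmount_between_amount hφ.1 hφ.2 het hrm R ℓ (bound_spec R ℓ).2 i

end Uniform

end UniformRule

theorem theorem3 {n l : ℕ} [NeZero n] (Ω : Fin l → ℝ) (hΩ : ∀ ℓ, 0 ≤ Ω ℓ)
    (φ : UniformRule.Rule n Ω) :
    (UniformRule.ParetoUndominatedStrategyProof φ ∧ UniformRule.EqualTreatment φ ∧
      UniformRule.ReplacementMonotonic φ) ↔ φ = UniformRule.multidimUniform n Ω := by
  constructor
  · rintro ⟨⟨hφ, hund⟩, het, hrm⟩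
    exact UniformRule.eq_multidimUniform_of_dominates hφ.2 <|
      hund _ UniformRule.multidimUniform_mem_phiStar
        (UniformRule.multidimUniform_dominates hφ het hrm)
  · rintro rfl
    refine ⟨⟨UniformRule.multidimUniform_mem_phiStar, fun ψ hψ h => ?_⟩,
      UniformRule.equalTreatment_multidimUniform, UniformRule.replacementMonotonic_multidimUniform⟩
    obtain rfl := UniformRule.eq_multidimUniform_of_dominates hψ.2 h
    exact h
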